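/- \textbf{Conventions.} Manifolds are Hausdorff, second countable topological manifolds without boundary; coverings are covering maps between path-connected spaces. An open dense subset $A$ of a locally connected space $Z$ is \emph{large} if $Z\setminus A$ does not locally separate $Z$, i.e. $U\cap A$ is connected for every connected open $U\subset Z$. A map $g\colon Y\to Z$ between locally connected Hausdorff spaces is a \emph{spread} if the components of the preimages of open sets of $Z$ form a basis of $Y$. A spread $g$ is \emph{complete} if for every $z\in Z$ and every choice, for each open connected neighbourhood $W$ of $z$, of a component $\Theta(W)$ of $g^{-1}(W)$ such that $\Theta(W_1)\subset\Theta(W_2)$ whenever $W_1\subset W_2$, one has $\bigcap_W\Theta(W)\neq\emptyset$. A complete spread $g\colon Y\to Z$ is a \emph{completion} of a spread $f'\colon X'\to Z$ if there is an embedding $i\colon X'\to Y$ with $i(X')\subset Y$ large and $g\circ i=f'$. A map $f\colon X\to Z$ from a Hausdorff space to a manifold is a \emph{completed covering} if there are large subsets $X'\subset X$ and $Z'\subset Z$ such that $f$ restricts to a covering $X'\to Z'$ and $f$ is a completion of $f|_{X'}\colon X'\to Z$. The \emph{branch set} $B_f$ is the set of points of the domain at which $f$ is not a local homeomorphism. If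 $f$ restricts to a covering $g\colon X'\to Z'$ between large subsets and $z_0\in Z'$, the \emph{monodromy group} of $f$ is $\pi(Z',z_0)/\operatorname{Ker}(\sigma_g)$, where $\sigma_g\colon \pi(Z',z_0)\to\operatorname{Sym}(g^{-1}\{z_0\})$ is the monodromy of $g$; up to isomorphism it does not depend on the choices. Let $f\colon X\to Z$ be a completed covering between manifolds. A \emph{monodromy representation} of $f$ is a triple $(Y,p,q)$, where $Y$ is a locally connected Hausdorff space on which the monodromy group $G$ of $f$ acts by homeomorphisms, such that for some subgroup $H\subset G$ the maps $p\colon Y\to X$ and $q\colon Y\to Z$ are the orbit maps of $H$ and $G$ (that is, $p$ and $q$ are the quotient maps $Y\to Y/H$ and $Y\to Y/G$ followed by homeomorphisms $Y/H\approx X$ and $Y/G\approx Z$), $p$ and $q$ are completed coverings, and $q=f\circ p$. \textbf{Theorem.} Let $f\colon X\to Z$ be a completed covering between manifolds, let $(Y,p,q)$ be a monodromy representation of $f$, and let $B_f\subset X$, $B_p\subset Y$ and $B_q\subset Y$ be the respective branch sets. Then $f(B_f)\subset Z$, $p(B_p)\subset X$ and $q(B_q)\subset Z$ are closed sets. -/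

import Mathlib

open Set Topology

noncomputable section

namespace BranchedCover

/-- An open dense subset `A` of `Z` is *large* if its complement does not locally separate `Z`:
a connected open set `U` stays connected when the complement is removed (leaving `U ∩ A`). -/
structure IsLarge {Z : Type*} [TopologicalSpace Z] (A : Set Z) : Prop where
  isOpen : IsOpen A
  dense : Dense A
  not_locally_separated : ∀ U : Set Z, IsOpen U → IsConnected U → IsConnected (U ∩ A)

/-- `C` is a (connected) component of the subset `S`. -/
def IsComponentOf {Y : Type*} [TopologicalSpace Y] (C S : Set Y) : Prop :=
  ∃ y ∈ S, C = connectedComponentIn S y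

/-- A covering map between path-connected spaces. -/
structure IsCovering {X Y : Type*} [TopologicalSpace X] [TopologicalSpace Y] (p : X → Y) :
    Prop where
  pathConnected_dom : PathConnectedSpace X
  pathConnected_cod : PathConnectedSpace Y
  isCoveringMap : IsCoveringMap p

/-- A *spread* is a map between locally connected Hausdorff spaces such that the components of the
preimages of open sets form a basis of the topology of the domain. -/
structure IsSpread {Y Z : Type*} [TopologicalSpace Y] [TopologicalSpace Z] (g : Y → Z) :
    Prop where
  t2_dom : T2Space Y
  t2_cod : T2Space Z
  locallyConnected_dom : LocallyConnectedSpace Y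
  locallyConnected_cod : LocallyConnectedSpace Z
  isTopologicalBasis : TopologicalSpace.IsTopologicalBasis
    {C : Set Y | ∃ W : Set Z, IsOpen W ∧ IsComponentOf C (g ⁻¹' W)}

/-- The open connected neighbourhoods of a point. -/
def connNhds {Z : Type*} [TopologicalSpace Z] (z : Z) : Set (Set Z) :=
  {W | IsOpen W ∧ IsConnected W ∧ z ∈ W}

/-- `Θ` is a *selection function* of `g` at `z`; only its values on `connNhds z` matter. -/
structure IsSelection {Y Z : Type*} [TopologicalSpace Y] [TopologicalSpace Z] (g : Y → Z) (z : Z)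
    (Θ : Set Z → Set Y) : Prop where
  isComponentOf : ∀ W ∈ connNhds z, IsComponentOf (Θ W) (g ⁻¹' W)
  mono : ∀ W₁ ∈ connNhds z, ∀ W₂ ∈ connNhds z, W₁ ⊆ W₂ → Θ W₁ ⊆ Θ W₂

/-- A spread is *complete* if for every selection function the selected components have a common
point. -/
structure IsCompleteSpread {Y Z : Type*} [TopologicalSpace Y] [TopologicalSpace Z] (g : Y → Z) :
    Prop where
  isSpread : IsSpread g
  complete : ∀ (z : Z) (Θ : Set Z → Set Y), IsSelection g z Θ → (⋂ W ∈ connNhds z, Θ W).Nonempty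

/-- The complete spread `g : Y → Z` is a *completion* of the spread `f : X → Z`: there is an
embedding of `X` onto a large subset of `Y` over `Z`. -/
structure IsCompletion {X Y Z : Type*} [TopologicalSpace X] [TopologicalSpace Y]
    [TopologicalSpace Z] (g : Y → Z) (f : X → Z) : Prop where
  isCompleteSpread : IsCompleteSpread g
  isSpread : IsSpread f
  exists_embedding : ∃ i : X → Y, IsEmbedding i ∧ IsLarge (range i) ∧ g ∘ i = f

/-- `f` restricts to a covering `X' → Z'` between large subsets of its domain and codomain. -/
structure RestrictsToCovering {X Z : Type*} [TopologicalSpace X] [TopologicalSpace Z] (f : X → Z)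
    (X' : Set X) (Z' : Set Z) : Prop where
  large_dom : IsLarge X'
  large_cod : IsLarge Z'
  mapsTo : MapsTo f X' Z'
  isCovering : IsCovering (mapsTo.restrict f X' Z')

/-- A *completed covering*: a map `f : X → Z` that restricts to a covering `X' → Z'` between large
subsets and is the completion of `f|X' : X' → Z`. -/
def IsCompletedCovering {X Z : Type*} [TopologicalSpace X] [TopologicalSpace Z] (f : X → Z) :
    Prop :=
  ∃ (X' : Set X) (Z' : Set Z), RestrictsToCovering f X' Z' ∧ IsCompletion f (fun x : X' => f x)

/-- The *branch set* of `f`: the points at which `f` is not a local homeomorphism. -/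
def branchSet {X Z : Type*} [TopologicalSpace X] [TopologicalSpace Z] (f : X → Z) : Set X :=
  {x | ¬ ∃ e : OpenPartialHomeomorph X Z, x ∈ e.source ∧ EqOn f e e.source}

/-- The *monodromy group* `π(Z', z₀) / Ker σ_g` of `f`, computed from a covering `g : X' → Z'`
between large subsets that `f` restricts to and a base point `z₀ ∈ Z'`; here
`σ_g : π(Z', z₀) → Sym(g⁻¹{z₀})` is the monodromy of `g`. -/
abbrev MonodromyGroup {X Z : Type*} [TopologicalSpace X] [TopologicalSpace Z] {f : X → Z}
    {X' : Set X} {Z' : Set Z} (h : RestrictsToCovering f X' Z') (z₀ : Z') : Type _ :=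
  FundamentalGroup Z' z₀ ⧸ (h.isCovering.isCoveringMap.monodromyPerm z₀).ker

/-- `q : Y → Z` is the orbit map of an action of `G` on `Y`: it is open and continuous, and it is
the canonical map `Y → Y/G` followed by a homeomorphism `Y/G → Z`. -/
structure IsOrbitMap (G : Type*) {Y Z : Type*} [Group G] [MulAction G Y] [TopologicalSpace Y]
    [TopologicalSpace Z] (q : Y → Z) : Prop where
  continuous : Continuous q
  isOpenMap : IsOpenMap q
  exists_homeomorph : ∃ φ : Quotient (MulAction.orbitRel G Y) ≃ₜ Z,
    ∀ y : Y, φ (Quotient.mk _ y) = q y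

/-- `(Y, p, q)` is a *monodromy representation* of `f : X → Z`. The action of the monodromy group
is by homeomorphisms (`ContinuousConstSMul`). The isomorphism class of the monodromy group does not
depend on the large subsets and the base point used to compute it. -/
structure IsMonodromyRepresentation {X Y Z : Type*} [TopologicalSpace X] [TopologicalSpace Y]
    [TopologicalSpace Z] (f : X → Z) (p : Y → X) (q : Y → Z) : Prop where
  t2Space : T2Space Y
  locallyConnectedSpace : LocallyConnectedSpace Y
  exists_action : ∃ (X' : Set X) (Z' : Set Z) (h : RestrictsToCovering f X' Z') (z₀ : Z')
    (_ : MulAction (MonodromyGroup h z₀) Y) (H : Subgroup (MonodromyGroup h z₀)),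
    ContinuousConstSMul (MonodromyGroup h z₀) Y ∧ IsOrbitMap (MonodromyGroup h z₀) q ∧
      IsOrbitMap H p
  isCompletedCovering_left : IsCompletedCovering p
  isCompletedCovering_right : IsCompletedCovering q
  comp_eq : q = f ∘ p

end BranchedCover

end

/-! For `p` and `q`: the group preserves the unbranched points of an orbit map, so the complement of
the image of the branch set is the image of the open unbranched set, and orbit maps are open
(`IsOrbitMap.isClosed_image_branchSet`).

For `f` there may be infinitely many points over `z`, and one neighbourhood of `z` must serve them
all. The fibre of `q` over `z` is countable (`IsOrbitMap.countable_fiber`), and a Baire-type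
diagonal argument with completeness makes one of its points `y` isolated: some component `C` of `q⁻¹
W` meets the fibre only in `y` (`IsCompleteSpread.exists_isolated`). Each translate `g • C` then
meets it only in `g • y`, so group elements preserving `g • C` fix `g • y`. If `p (g • y)` is
unbranched for `f`, such elements act as elements of `H` (`apply_smul_eq_of_notMem_branchSet`), so
`f` is injective on `p (g • C)`. Hence if `z` is outside the image of the branch set, so is its
whole neighbourhood `q (C)`. -/

open BranchedCover TopologicalSpace Filter

/-! ### Countability of the fibres of a covering -/

/-- A preconnected space covered by nonempty open sets, each of which meets only countably many
others, is covered by countably many of them. -/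
theorem countable_index_of_countable_inter {E ι : Type*} [TopologicalSpace E] [PreconnectedSpace E]
    {S : ι → Set E} (ho : ∀ i, IsOpen (S i)) (hne : ∀ i, (S i).Nonempty)
    (hcov : ∀ e, ∃ i, e ∈ S i) (hc : ∀ i, {j | (S i ∩ S j).Nonempty}.Countable) :
    Countable ι := by
  rcases isEmpty_or_nonempty ι with h | ⟨⟨i₀⟩⟩
  · infer_instance
  -- Indices reachable from `i₀` by a chain of `n` overlaps.
  let R : ℕ → Set ι := fun n => Nat.rec {i₀} (fun _ A => ⋃ i ∈ A, {j | (S i ∩ S j).Nonempty}) n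
  have hR : ∀ n, (R n).Countable := by
    intro n
    induction n with
    | zero => exact countable_singleton i₀
    | succ n ih => exact ih.biUnion fun i _ => hc i
  have hstep : ∀ i j, i ∈ ⋃ n, R n → (S i ∩ S j).Nonempty → j ∈ ⋃ n, R n := by
    intro i j hi hij
    obtain ⟨n, hn⟩ := mem_iUnion.1 hi
    exact mem_iUnion.2 ⟨n + 1, mem_biUnion (t := fun i => {j | (S i ∩ S j).Nonempty}) hn hij⟩
  set T := ⋃ n, R n with hT
  have hTc : T.Countable := countable_iUnion hR
  have h0 : i₀ ∈ T := mem_iUnion.2 ⟨0, rfl⟩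
  have hclopen : IsClopen (⋃ i ∈ T, S i) := by
    refine ⟨⟨?_⟩, isOpen_biUnion fun i _ => ho i⟩
    have : (⋃ i ∈ T, S i)ᶜ = ⋃ i ∈ Tᶜ, S i := by
      ext e
      simp only [mem_compl_iff, mem_iUnion, not_exists]
      constructor
      · intro h
        obtain ⟨i, hi⟩ := hcov e
        exact ⟨i, fun hiT => h i hiT hi, hi⟩
      · rintro ⟨j, hj, hej⟩ i hi hei
        exact hj (hstep i j hi ⟨e, hei, hej⟩)
    rw [this]
    exact isOpen_biUnion fun i _ => ho i
  have huniv : (⋃ i ∈ T, S i) = univ := by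
    refine hclopen.eq_univ ?_
    obtain ⟨e, he⟩ := hne i₀
    exact ⟨e, mem_biUnion h0 he⟩
  have hTu : T = univ := by
    refine eq_univ_of_forall fun j => ?_
    obtain ⟨e, he⟩ := hne j
    have : e ∈ ⋃ i ∈ T, S i := huniv ▸ mem_univ e
    obtain ⟨i, hi, hei⟩ := mem_iUnion₂.1 this
    exact hstep i j hi ⟨e, hei, he⟩
  exact countable_univ_iff.1 (hTu ▸ hTc)

/-- The sheets of a trivialization with discrete fibre are open. -/
theorem Bundle.Trivialization.isOpen_sheet {E B I : Type*} [TopologicalSpace E] [TopologicalSpace B]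
    [TopologicalSpace I] [DiscreteTopology I] {f : E → B} (t : Bundle.Trivialization I f) (a : I) :
    IsOpen (t.source ∩ (fun e => (t e).2) ⁻¹' {a}) :=
  (continuous_snd.comp_continuousOn t.continuousOn_toFun).isOpen_inter_preimage t.open_source
    (isOpen_discrete _)

/-- A sheet of one trivialization meets only countably many sheets of another one. -/
theorem Bundle.Trivialization.countable_sheet_inter {E B I J : Type*} [TopologicalSpace E]
    [TopologicalSpace B] [SecondCountableTopology B] [TopologicalSpace I]
    [TopologicalSpace J] [DiscreteTopology J] {f : E → B} (t : Bundle.Trivialization I f)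
    (u : Bundle.Trivialization J f) (a : I) :
    {c | ((t.source ∩ (fun e => (t e).2) ⁻¹' {a}) ∩
      (u.source ∩ (fun e => (u e).2) ⁻¹' {c})).Nonempty}.Countable := by
  -- The section through sheet `a`. The sets `O c` where it lands in sheet `c` are disjoint and open
  -- in a second countable base.
  let s : B → E := fun x => t.toOpenPartialHomeomorph.symm (x, a)
  have hs : ContinuousOn s t.baseSet := by
    refine t.toOpenPartialHomeomorph.continuousOn_symm.comp (by fun_prop) fun x hx => ?_
    exact t.mem_target.2 hx
  let O : J → Set B := fun c => t.baseSet ∩ s ⁻¹' (u.source ∩ (fun e => (u e).2) ⁻¹' {c})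
  refine PairwiseDisjoint.countable_of_isOpen (s := O) ?_ ?_ ?_
  · intro c _ d _ hcd
    refine Set.disjoint_left.2 fun x hx hx' => hcd ?_
    exact hx.2.2.symm.trans hx'.2.2
  · exact fun c _ => hs.isOpen_inter_preimage t.open_baseSet (u.isOpen_sheet c)
  · rintro c ⟨e, ⟨he, hea⟩, hu⟩
    refine ⟨f e, t.mem_source.1 he, ?_⟩
    have : s (f e) = e := by
      have h1 : (f e, a) = t e := Prod.ext (t.proj_toFun e he).symm hea.symm
      change t.toOpenPartialHomeomorph.symm (f e, a) = e
      rw [h1]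
      exact t.toOpenPartialHomeomorph.left_inv he
    rw [mem_preimage, this]
    exact hu

/-- The fibres of a covering of a second countable space by a connected space are countable. -/
theorem IsCoveringMap.countable_fiber {E B : Type*} [TopologicalSpace E] [TopologicalSpace B]
    [PreconnectedSpace E] [SecondCountableTopology B] {f : E → B} (hf : IsCoveringMap f) (b : B) :
    (f ⁻¹' {b}).Countable := by
  have hne : ∀ e, Nonempty (f ⁻¹' {f e}) := fun e => ⟨⟨e, rfl⟩⟩
  have hd : ∀ e, DiscreteTopology (f ⁻¹' {f e}) := fun e => (hf (f e)).discreteTopology_fiber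
  let t : ∀ e : E, Bundle.Trivialization (f ⁻¹' {f e}) f := fun e => (hf (f e)).toTrivialization
  have ht : ∀ e, f e ∈ (t e).baseSet := fun e => (hf (f e)).mem_toTrivialization_baseSet
  -- Lindelöf: countably many trivializations suffice.
  obtain ⟨T, hTc, hT⟩ := isOpen_iUnion_countable (fun e => (t e).baseSet)
    fun e => (t e).open_baseSet
  have hTcov : ∀ e, ∃ i : T, e ∈ (t i).source := by
    intro e
    have : f e ∈ ⋃ i ∈ T, (t i).baseSet := hT ▸ mem_iUnion.2 ⟨e, ht e⟩
    obtain ⟨i, hi, hei⟩ := mem_iUnion₂.1 this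
    exact ⟨⟨i, hi⟩, (t i).mem_source.2 hei⟩
  have := hTc.to_subtype
  let S : (Σ i : T, f ⁻¹' {f i}) → Set E :=
    fun x => (t x.1).source ∩ (fun e => (t x.1 e).2) ⁻¹' {x.2}
  have hcount : Countable (Σ i : T, f ⁻¹' {f i}) := by
    refine countable_index_of_countable_inter (S := S) (fun x => (t x.1).isOpen_sheet x.2) ?_ ?_ ?_
    · rintro ⟨i, a⟩
      have hm : (f i, a) ∈ (t i).target := (t i).mem_target.2 (ht i)
      refine ⟨(t i).toOpenPartialHomeomorph.symm (f i, a),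
        (t i).toOpenPartialHomeomorph.map_target hm, ?_⟩
      exact congrArg Prod.snd ((t i).toOpenPartialHomeomorph.right_inv hm)
    · intro e
      obtain ⟨i, hi⟩ := hTcov e
      exact ⟨⟨i, (t i e).2⟩, hi, rfl⟩
    · rintro ⟨i, a⟩
      refine (countable_iUnion fun j : T =>
        ((t i).countable_sheet_inter (t j) a).image (Sigma.mk (β := fun i : T => f ⁻¹' {f i}) j)).mono ?_
      rintro ⟨j, c⟩ h
      exact mem_iUnion.2 ⟨j, c, h, rfl⟩
  rcases (f ⁻¹' {b}).eq_empty_or_nonempty with h | ⟨e, he⟩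
  · rw [h]; exact countable_empty
  obtain ⟨i, hi⟩ := hTcov e
  have hfib : Countable (f ⁻¹' {f i}) := 
    (sigma_mk_injective (β := fun i : T => f ⁻¹' {f i}) (i := i)).countable
  refine MapsTo.countable_of_injOn (f := fun e => (t i e).2) (t := univ) (fun _ _ => mem_univ _) ?_
    (countable_univ)
  have hsrc : ∀ e' ∈ f ⁻¹' {b}, e' ∈ (t i).source := by
    intro e' he'
    rw [(t i).mem_source] at hi ⊢
    rw [mem_preimage, mem_singleton_iff] at he he'
    rwa [he', ← he]
  intro e₁ h₁ e₂ h₂ h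
  refine (t i).injOn (hsrc _ h₁) (hsrc _ h₂) (Prod.ext ?_ h)
  rw [(t i).proj_toFun _ (hsrc _ h₁), (t i).proj_toFun _ (hsrc _ h₂)]
  exact h₁.trans h₂.symm

namespace BranchedCover

/-! ### Branch sets and local injectivity -/

variable {X Y Z : Type*} [TopologicalSpace X] [TopologicalSpace Y] [TopologicalSpace Z]

theorem isOpen_compl_branchSet (f : X → Z) : IsOpen (branchSet f)ᶜ := by
  refine isOpen_iff_mem_nhds.2 fun x hx => ?_
  obtain ⟨e, hxe, he⟩ := not_not.1 hx
  exact mem_of_superset (e.open_source.mem_nhds hxe) fun x' hx' => not_not.2 ⟨e, hx', he⟩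

theorem exists_isOpen_injOn_of_notMem_branchSet {f : X → Z} {x : X} (hx : x ∉ branchSet f) :
    ∃ U, IsOpen U ∧ x ∈ U ∧ InjOn f U := by
  obtain ⟨e, hxe, he⟩ := not_not.1 hx
  exact ⟨e.source, e.open_source, hxe, e.injOn.congr he.symm⟩

theorem notMem_branchSet_of_injOn {f : X → Z} (hf : Continuous f) (hfo : IsOpenMap f) {U : Set X}
    (hU : IsOpen U) (hinj : InjOn f U) {x : X} (hx : x ∈ U) : x ∉ branchSet f := by
  have : Nonempty X := ⟨x⟩
  exact not_not.2 ⟨OpenPartialHomeomorph.ofContinuousOpen (hinj.toPartialEquiv f U)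
    hf.continuousOn hfo hU, hx, fun _ _ => rfl⟩

/-! ### Orbit maps -/

namespace IsOrbitMap

variable {G : Type*} [Group G] [MulAction G Y] {q : Y → Z}

theorem eq_iff (hq : IsOrbitMap G q) {y y' : Y} : q y = q y' ↔ ∃ g : G, g • y' = y := by
  obtain ⟨φ, hφ⟩ := hq.exists_homeomorph
  rw [← hφ, ← hφ, φ.injective.eq_iff, Quotient.eq, MulAction.orbitRel_apply]
  rfl

theorem apply_smul (hq : IsOrbitMap G q) (g : G) (y : Y) : q (g • y) = q y :=
  hq.eq_iff.2 ⟨g, rfl⟩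

theorem surjective (hq : IsOrbitMap G q) : Function.Surjective q := by
  obtain ⟨φ, hφ⟩ := hq.exists_homeomorph
  intro z
  obtain ⟨y, hy⟩ := Quotient.exists_rep (φ.symm z)
  exact ⟨y, by rw [← hφ, hy, φ.apply_symm_apply]⟩

/-- Since `q` is invariant, injectivity on `U` transfers to the translate of `U` by `g`. -/
theorem smul_notMem_branchSet [ContinuousConstSMul G Y] (hq : IsOrbitMap G q) {y : Y}
    (hy : y ∉ branchSet q) (g : G) : g • y ∉ branchSet q := by
  obtain ⟨U, hU, hyU, hinj⟩ := exists_isOpen_injOn_of_notMem_branchSet hy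
  refine notMem_branchSet_of_injOn hq.continuous hq.isOpenMap (U := (g⁻¹ • ·) ⁻¹' U)
    (hU.preimage (continuous_const_smul _)) ?_ (by simpa using hyU)
  intro a ha b hb hab
  have := hinj ha hb (by simpa [hq.apply_smul] using hab)
  exact MulAction.injective g⁻¹ this

/-- The image of the branch set of an orbit map is closed. -/
theorem isClosed_image_branchSet [ContinuousConstSMul G Y] (hq : IsOrbitMap G q) :
    IsClosed (q '' branchSet q) := by
  have h : (q '' branchSet q)ᶜ = q '' (branchSet q)ᶜ := by
    ext z
    constructor
    · intro hz
      obtain ⟨y, rfl⟩ := hq.surjective z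
      exact ⟨y, fun hy => hz ⟨y, hy, rfl⟩, rfl⟩
    · rintro ⟨y, hy, rfl⟩ ⟨y', hy', h⟩
      obtain ⟨g, rfl⟩ := hq.eq_iff.1 h
      exact hq.smul_notMem_branchSet hy g hy'
  rw [← isOpen_compl_iff, h]
  exact hq.isOpenMap _ (isOpen_compl_branchSet q)

theorem image_smul_preimage (hq : IsOrbitMap G q) (W : Set Z) (g : G) :
    (g • ·) '' (q ⁻¹' W) = q ⁻¹' W := by
  ext y
  constructor
  · rintro ⟨y, hy, rfl⟩
    simpa [hq.apply_smul] using hy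
  · intro hy
    exact ⟨g⁻¹ • y, by simpa [hq.apply_smul] using hy, smul_inv_smul g y⟩

/-- The group permutes the components of the preimage of a set. -/
theorem smul_mem_connectedComponentIn [ContinuousConstSMul G Y] (hq : IsOrbitMap G q) {W : Set Z}
    {y v : Y} (g : G) (hv : v ∈ connectedComponentIn (q ⁻¹' W) y) :
    g • v ∈ connectedComponentIn (q ⁻¹' W) (g • y) := by
  have hy : y ∈ q ⁻¹' W := by
    by_contra h
    rw [connectedComponentIn_eq_empty h] at hv
    exact hv
  have h := (continuous_const_smul (T := Y) g).continuousOn.image_connectedComponentIn_subset hy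
  rw [hq.image_smul_preimage] at h
  exact h ⟨v, hv, rfl⟩

/-- A group element that fixes a point of the total space of the covering acts trivially. -/
theorem smul_eq_of_smul_eq [T2Space Y] [ContinuousConstSMul G Y] (hq : IsOrbitMap G q)
    {Y' : Set Y} {Z' : Set Z} (h : RestrictsToCovering q Y' Z') {g : G} {y : Y} (hy : y ∈ Y')
    (hgy : g • y = y) (v : Y) : g • v = v := by
  have hclosed : IsClosed {v : Y | g • v = v} :=
    isClosed_eq (continuous_const_smul g) continuous_id
  have := h.isCovering.pathConnected_dom
  -- Near a fixed point `v`, both `w` and `g • w` lie in a set where `q` is injective, and they have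
  -- the same image.
  have hopen : IsOpen {v : Y' | g • (v : Y) = v} := by
    refine isOpen_iff_mem_nhds.2 fun v hv => ?_
    obtain ⟨e, hve, he⟩ := h.isCovering.isCoveringMap.isLocalHomeomorph v
    have hinj : InjOn q (Subtype.val '' e.source) := by
      rintro _ ⟨a, ha, rfl⟩ _ ⟨b, hb, rfl⟩ hab
      refine congrArg Subtype.val (e.injOn ha hb ?_)
      rw [← he]
      exact Subtype.ext hab
    have hO : IsOpen (Subtype.val '' e.source : Set Y) :=
      h.large_dom.isOpen.isOpenMap_subtype_val _ e.open_source
    have h1 : (fun w : Y' => g • (w : Y)) ⁻¹' (Subtype.val '' e.source) ∈ 𝓝 v := by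
      refine ((continuous_const_smul g).comp continuous_subtype_val).continuousAt.preimage_mem_nhds
        (hO.mem_nhds ?_)
      change g • (v : Y) ∈ _
      rw [show g • (v : Y) = v from hv]
      exact ⟨v, hve, rfl⟩
    filter_upwards [h1, e.open_source.mem_nhds hve] with w hw hw'
    exact hinj hw ⟨w, hw', rfl⟩ (hq.apply_smul g _)
  have huniv : {v : Y' | g • (v : Y) = v} = univ :=
    IsClopen.eq_univ ⟨hclosed.preimage continuous_subtype_val, hopen⟩ ⟨⟨y, hy⟩, hgy⟩
  have hsub : Y' ⊆ {v : Y | g • v = v} := fun w hw => by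
    have : (⟨w, hw⟩ : Y') ∈ {v : Y' | g • (v : Y) = v} := huniv ▸ mem_univ _
    exact this
  exact hclosed.closure_subset_iff.2 hsub (h.large_dom.dense v)

/-- The fibres of an orbit map that restricts to a covering are countable. -/
theorem countable_fiber [T2Space Y] [SecondCountableTopology Z] [ContinuousConstSMul G Y]
    (hq : IsOrbitMap G q) {Y' : Set Y} {Z' : Set Z} (h : RestrictsToCovering q Y' Z') (z : Z) :
    (q ⁻¹' {z}).Countable := by
  obtain ⟨D, hDc, hD⟩ := exists_countable_dense Z
  have := h.isCovering.pathConnected_dom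
  have hfib : ∀ d, (Y' ∩ q ⁻¹' {d}).Countable := by
    intro d
    by_cases hd : d ∈ Z'
    · refine ((h.isCovering.isCoveringMap.countable_fiber ⟨d, hd⟩).image Subtype.val).mono ?_
      rintro y ⟨hy, hyd⟩
      exact ⟨⟨y, hy⟩, Subtype.ext hyd, rfl⟩
    · convert countable_empty
      refine eq_empty_of_forall_notMem ?_
      rintro y ⟨hy, rfl⟩
      exact hd (h.mapsTo hy)
  let F : Set Y := ⋃ d ∈ D, Y' ∩ q ⁻¹' {d}
  have hF : F.Countable := hDc.biUnion fun d _ => hfib d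
  obtain ⟨y, hy⟩ := hq.surjective z
  -- Each `g` is encoded by a pair in the countable set `F`; two elements with the same code agree
  -- at a point of `Y'`, hence everywhere.
  have hpair : ∀ g : G, ∃ c : Y × Y, c ∈ F ×ˢ F ∧ g • c.1 = c.2 := by
    intro g
    have hO : IsOpen (Y' ∩ (g • ·) ⁻¹' Y') :=
      h.large_dom.isOpen.inter (h.large_dom.isOpen.preimage (continuous_const_smul g))
    have hne : (Y' ∩ (g • ·) ⁻¹' Y').Nonempty := by
      rw [inter_comm]
      refine h.large_dom.dense.inter_open_nonempty _
        (h.large_dom.isOpen.preimage (continuous_const_smul g)) ?_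
      obtain ⟨w, hw⟩ := h.isCovering.pathConnected_dom.nonempty
      exact ⟨g⁻¹ • w, by simpa using hw⟩
    obtain ⟨d, ⟨w, ⟨hw, hgw⟩, rfl⟩, hd⟩ :=
      hD.inter_open_nonempty _ (hq.isOpenMap _ hO) (hne.image q)
    exact ⟨(w, g • w), ⟨mem_biUnion hd ⟨hw, rfl⟩, mem_biUnion hd ⟨hgw, hq.apply_smul g w⟩⟩, rfl⟩
  choose c hcF hc using hpair
  have hmem : ∀ y' ∈ q ⁻¹' {z}, ∃ g : G, g • y = y' := fun y' hy' =>
    hq.eq_iff.1 ((show q y' = z from hy').trans hy.symm)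
  choose! γ hγ using hmem
  refine MapsTo.countable_of_injOn (f := fun y' => c (γ y')) (t := F ×ˢ F)
    (fun y' _ => hcF _) ?_ (hF.prod hF)
  intro a ha b hb hab
  have h1 : ((γ b)⁻¹ * γ a) • (c (γ a)).1 = (c (γ a)).1 := by
    have hab' : c (γ a) = c (γ b) := hab
    rw [mul_smul, hc, hab', ← hc, inv_smul_smul]
  have h2 : (c (γ a)).1 ∈ Y' := by
    obtain ⟨d, _, hd⟩ := mem_iUnion₂.1 (hcF (γ a)).1
    exact hd.1
  have h3 := hq.smul_eq_of_smul_eq h h2 h1 y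
  rw [mul_smul, inv_smul_eq_iff, hγ a ha, hγ b hb] at h3
  exact h3

end IsOrbitMap

/-! ### Isolated points in countable fibres of complete spreads -/

theorem IsSpread.exists_connNhds_subset {q : Y → Z} (hq : IsSpread q) {y : Y} {U : Set Y}
    (hU : IsOpen U) (hy : y ∈ U) {V : Set Z} (hV : IsOpen V) (hyV : q y ∈ V) :
    ∃ W ∈ connNhds (q y), W ⊆ V ∧ connectedComponentIn (q ⁻¹' W) y ⊆ U := by
  have := hq.locallyConnected_cod
  obtain ⟨C, ⟨W, hW, a, ha, rfl⟩, hyC, hCU⟩ := hq.isTopologicalBasis.exists_subset_of_mem_open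
    hy hU
  have hyW : y ∈ q ⁻¹' W := connectedComponentIn_subset _ _ hyC
  have hyWV : q y ∈ W ∩ V := ⟨hyW, hyV⟩
  refine ⟨connectedComponentIn (W ∩ V) (q y), ⟨(hW.inter hV).connectedComponentIn,
    isConnected_connectedComponentIn_iff.2 hyWV, mem_connectedComponentIn hyWV⟩,
    (connectedComponentIn_subset _ _).trans inter_subset_right, ?_⟩
  rw [connectedComponentIn_eq hyC] at hCU
  exact (connectedComponentIn_mono _ (preimage_mono
    ((connectedComponentIn_subset _ _).trans inter_subset_left))).trans hCU

/-- A nonempty countable fibre of a complete spread has an isolated point. -/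
theorem IsCompleteSpread.exists_isolated {q : Y → Z} (hq : IsCompleteSpread q)
    [FirstCountableTopology Z] {z : Z} (hc : (q ⁻¹' {z}).Countable) (hne : (q ⁻¹' {z}).Nonempty) :
    ∃ W ∈ connNhds z, ∃ y ∈ q ⁻¹' {z},
      ∀ v ∈ connectedComponentIn (q ⁻¹' W) y, q v = z → v = y := by
  have := hq.isSpread.t2_dom
  have := hq.isSpread.t2_cod
  have := hq.isSpread.locallyConnected_cod
  by_contra! hcon
  obtain ⟨e, he⟩ := hc.exists_eq_range hne
  obtain ⟨B, hB⟩ := (𝓝 z).exists_antitone_basis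
  let P : Type _ := {s : Set Z × Y // s.1 ∈ connNhds z ∧ q s.2 = z}
  -- Diagonal step: without isolated points, one can move within the fibre off `e j`, then shrink to
  -- a component omitting `e j`.
  have step : ∀ (j : ℕ) (s : P), ∃ s' : P, s'.1.1 ⊆ s.1.1 ∧ s'.1.1 ⊆ B j ∧
      s'.1.2 ∈ connectedComponentIn (q ⁻¹' s.1.1) s.1.2 ∧
      e j ∉ connectedComponentIn (q ⁻¹' s'.1.1) s'.1.2 := by
    rintro j ⟨⟨W, y⟩, hW, hy⟩
    obtain ⟨y', hy'C, hy', hne'⟩ : ∃ y' ∈ connectedComponentIn (q ⁻¹' W) y, q y' = z ∧ y' ≠ e j := by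
      by_cases h : y = e j
      · obtain ⟨v, hvC, hv, hvy⟩ := hcon W hW y hy
        exact ⟨v, hvC, hv, h ▸ hvy⟩
      · have : q y ∈ W := by rw [show q y = z from hy]; exact hW.2.2
        exact ⟨y, mem_connectedComponentIn this, hy, h⟩
    have hV : interior (B j) ∩ W ∈ 𝓝 z :=
      inter_mem (interior_mem_nhds.2 (hB.1.mem_of_mem trivial)) (hW.1.mem_nhds hW.2.2)
    obtain ⟨W', hW', hW'V, hC⟩ := hq.isSpread.exists_connNhds_subset
      (isOpen_compl_singleton (x := e j)) hne' (isOpen_interior.inter hW.1)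
      (hy' ▸ mem_of_mem_nhds hV)
    rw [hy'] at hW'
    exact ⟨⟨(W', y'), hW', hy'⟩, hW'V.trans inter_subset_right,
      hW'V.trans (inter_subset_left.trans interior_subset), hy'C, fun h => hC h rfl⟩
  choose next h1 h2 h3 h4 using step
  obtain ⟨y₀, hy₀⟩ := hne
  have hz₀ : connectedComponentIn univ z ∈ connNhds z :=
    ⟨isOpen_univ.connectedComponentIn, isConnected_connectedComponentIn_iff.2 (mem_univ z),
      mem_connectedComponentIn (mem_univ z)⟩
  let s : ℕ → P := fun n => Nat.rec ⟨(connectedComponentIn univ z, y₀), hz₀, hy₀⟩ (fun j s => next j s) n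
  have hsucc : ∀ n, s (n + 1) = next n (s n) := fun n => rfl
  let W : ℕ → Set Z := fun n => (s n).1.1
  let y : ℕ → Y := fun n => (s n).1.2
  have hW : ∀ n, W n ∈ connNhds z := fun n => (s n).2.1
  have hy : ∀ n, q (y n) = z := fun n => (s n).2.2
  have hanti : Antitone W := antitone_nat_of_succ_le fun n => h1 n (s n)
  -- The component over `V` stabilizes once `W i ⊆ V`, which makes the selection below independent
  -- of the choice of `ν V`.
  have hC : ∀ i j, i ≤ j → ∀ V, W i ⊆ V →
      connectedComponentIn (q ⁻¹' V) (y i) = connectedComponentIn (q ⁻¹' V) (y j) := by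
    intro i j hij
    induction j, hij using Nat.le_induction with
    | base => exact fun _ _ => rfl
    | succ j hij ih =>
      intro V hV
      rw [ih V hV]
      refine connectedComponentIn_eq ?_
      exact connectedComponentIn_mono _ (preimage_mono ((hanti hij).trans hV)) (h3 j (s j))
  have hex : ∀ V ∈ connNhds z, ∃ i, W i ⊆ V := by
    intro V hV
    obtain ⟨j, -, hj⟩ := hB.1.mem_iff.1 (hV.1.mem_nhds hV.2.2)
    exact ⟨j + 1, (h2 j (s j)).trans hj⟩
  choose! ν hν using hex
  have hsel : IsSelection q z fun V => connectedComponentIn (q ⁻¹' V) (y (ν V)) := by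
    refine ⟨fun V hV => ⟨y (ν V), ?_, rfl⟩, fun V₁ hV₁ V₂ hV₂ hV => ?_⟩
    · rw [mem_preimage, hy]; exact hV.2.2
    · rw [hC (ν V₁) _ (le_max_left (ν V₁) (ν V₂)) V₁ (hν V₁ hV₁),
        hC (ν V₂) _ (le_max_right (ν V₁) (ν V₂)) V₂ (hν V₂ hV₂)]
      exact connectedComponentIn_mono _ (preimage_mono hV)
  obtain ⟨a, ha⟩ := hq.complete z _ hsel
  rw [mem_iInter₂] at ha
  -- Otherwise a connected neighbourhood of `z` avoids `q a`.
  have haz : q a = z := by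
    by_contra hne'
    have hmem : z ∈ ({q a}ᶜ : Set Z) := fun h => hne' h.symm
    have hV : connectedComponentIn ({q a}ᶜ : Set Z) z ∈ connNhds z :=
      ⟨isOpen_compl_singleton.connectedComponentIn, isConnected_connectedComponentIn_iff.2 hmem,
        mem_connectedComponentIn hmem⟩
    have := connectedComponentIn_subset _ _ (ha _ hV)
    exact connectedComponentIn_subset _ _ (show q a ∈ _ from this) rfl
  obtain ⟨j, hj⟩ : a ∈ range e := he ▸ haz
  have h5 := ha _ (hW (j + 1))
  rw [hC _ _ (le_max_left _ (j + 1)) _ (hν _ (hW (j + 1))),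
    ← hC (j + 1) _ (le_max_right _ _) _ subset_rfl, ← hj] at h5
  exact h4 j (s j) h5

/-! ### The branch set of the induced map -/

/-- If `k` fixes a point over an unbranched point of `f`, then `k` maps each point into its orbit
under the smaller group. -/
theorem apply_smul_eq_of_notMem_branchSet {G : Type*} [Group G] [MulAction G Y]
    [ContinuousConstSMul G Y] [T2Space Y] {H : Subgroup G} {f : X → Z} {p : Y → X} {q : Y → Z}
    (hq : IsOrbitMap G q) (hp : IsOrbitMap H p) (hf : q = f ∘ p) {Y' : Set Y} {Z' : Set Z}
    (h : RestrictsToCovering q Y' Z') {k : G} {y : Y} (hk : k • y = y) (hy : p y ∉ branchSet f)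
    (v : Y) : p (k • v) = p v := by
  obtain ⟨U, hU, hyU, hinj⟩ := exists_isOpen_injOn_of_notMem_branchSet hy
  have hO : IsOpen (p ⁻¹' U ∩ (k • ·) ⁻¹' (p ⁻¹' U)) :=
    (hU.preimage hp.continuous).inter
      ((hU.preimage hp.continuous).preimage (continuous_const_smul k))
  -- Density moves the comparison to a point `w` of `Y'`, where stabilizers act trivially.
  obtain ⟨w, ⟨hw, hkw⟩, hwY⟩ := h.large_dom.dense.inter_open_nonempty _ hO
    ⟨y, hyU, by simpa [hk] using hyU⟩
  have hpw : p (k • w) = p w := by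
    refine hinj hkw hw ?_
    have := hq.apply_smul k w
    rwa [hf] at this
  obtain ⟨g, hg⟩ := hp.eq_iff.1 hpw
  have hfix : ((g : G)⁻¹ * k) • w = w := by
    rw [mul_smul, ← hg, Subgroup.smul_def, inv_smul_smul]
  have hv := hq.smul_eq_of_smul_eq h hwY hfix v
  rw [mul_smul, inv_smul_eq_iff] at hv
  rw [hv]
  exact hp.apply_smul g v

/-- If `f` is the map between orbit spaces induced by a complete spread that restricts to a
covering, then the image of its branch set is closed. -/
theorem isClosed_image_branchSet_of_orbitMaps {G : Type*} [Group G] [MulAction G Y]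
    [ContinuousConstSMul G Y] [SecondCountableTopology Z] {H : Subgroup G} {f : X → Z} {p : Y → X}
    {q : Y → Z} (hq : IsOrbitMap G q) (hp : IsOrbitMap H p) (hf : q = f ∘ p)
    (hcs : IsCompleteSpread q) {Y' : Set Y} {Z' : Set Z} (h : RestrictsToCovering q Y' Z') :
    IsClosed (f '' branchSet f) := by
  have := hcs.isSpread.t2_dom
  have := hcs.isSpread.locallyConnected_dom
  have hfc : Continuous f :=
    (hp.isOpenMap.isQuotientMap hp.continuous hp.surjective).continuous_iff.2 (hf ▸ hq.continuous)
  have hfo : IsOpenMap f := fun U hU => by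
    have := hq.isOpenMap _ (hU.preimage hp.continuous)
    rwa [hf, image_comp, image_preimage_eq U hp.surjective] at this
  rw [← isOpen_compl_iff]
  refine isOpen_iff_mem_nhds.2 fun z hz => ?_
  obtain ⟨W, hW, y, hy, hiso⟩ := hcs.exists_isolated (hq.countable_fiber h z)
    (hq.surjective z)
  have hy : q y = z := hy
  have hyW : y ∈ q ⁻¹' W := by rw [mem_preimage, hy]; exact hW.2.2
  have hWo : IsOpen (q ⁻¹' W) := hW.1.preimage hq.continuous
  refine mem_of_superset ((hq.isOpenMap _ (hWo.connectedComponentIn (x := y))).mem_nhds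
    ⟨y, mem_connectedComponentIn hyW, hy⟩) ?_
  rintro _ ⟨v, hv, rfl⟩ ⟨x, hx, hxv⟩
  obtain ⟨y₁, rfl⟩ := hp.surjective x
  have hqv : q y₁ = q v := by rw [← hxv, hf]; rfl
  obtain ⟨g, rfl⟩ := hq.eq_iff.1 hqv
  have hisog : ∀ w ∈ connectedComponentIn (q ⁻¹' W) (g • y), q w = z → w = g • y := by
    intro w hw hwz
    have := hq.smul_mem_connectedComponentIn g⁻¹ hw
    rw [inv_smul_smul] at this
    exact inv_smul_eq_iff.1 (hiso _ this (by rw [hq.apply_smul, hwz]))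
  have hgy : q (g • y) = z := by rw [hq.apply_smul, hy]
  have hpgy : p (g • y) ∉ branchSet f := fun hb => hz ⟨_, hb, by rw [← hgy, hf]; rfl⟩
  refine notMem_branchSet_of_injOn hfc hfo (U := p '' connectedComponentIn (q ⁻¹' W) (g • y))
    (hp.isOpenMap _ hWo.connectedComponentIn) ?_
    (mem_image_of_mem p (hq.smul_mem_connectedComponentIn g hv)) hx
  rintro _ ⟨a, ha, rfl⟩ _ ⟨b, hb, rfl⟩ hab
  have hqab : q a = q b := by rw [hf]; exact hab
  obtain ⟨k, rfl⟩ := hq.eq_iff.1 hqab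
  refine apply_smul_eq_of_notMem_branchSet hq hp hf h (y := g • y) ?_ hpgy b
  -- `k` preserves the component, which contains both `b` and `k • b`; so `k • g • y` lies in it
  -- over `z`.
  refine hisog _ ?_ (by rw [hq.apply_smul, hgy])
  have h1 := connectedComponentIn_eq (hq.smul_mem_connectedComponentIn k hb)
  rw [connectedComponentIn_eq ha, ← h1]
  exact mem_connectedComponentIn (by rw [mem_preimage, hq.apply_smul, hgy]; exact hW.2.2)

end BranchedCover

theorem mainTheorem7 {m n : ℕ} {X Y Z : Type*}
    [TopologicalSpace X] [T2Space X] [SecondCountableTopology X]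
    [ChartedSpace (EuclideanSpace ℝ (Fin m)) X]
    [TopologicalSpace Z] [T2Space Z] [SecondCountableTopology Z]
    [ChartedSpace (EuclideanSpace ℝ (Fin n)) Z]
    [TopologicalSpace Y]
    (f : X → Z) (hf : BranchedCover.IsCompletedCovering f)
    (p : Y → X) (q : Y → Z) (hpq : BranchedCover.IsMonodromyRepresentation f p q) :
    IsClosed (f '' BranchedCover.branchSet f) ∧
      IsClosed (p '' BranchedCover.branchSet p) ∧
      IsClosed (q '' BranchedCover.branchSet q)
 := by
  obtain ⟨_, _, _, _, _, H, _, hq, hp⟩ := hpq.exists_action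
  obtain ⟨Y', Z', hr, hc⟩ := hpq.isCompletedCovering_right
  have : ContinuousConstSMul H Y := ⟨fun g => continuous_const_smul g.1⟩
  exact ⟨BranchedCover.isClosed_image_branchSet_of_orbitMaps hq hp hpq.comp_eq hc.isCompleteSpread
    hr, hp.isClosed_image_branchSet, hq.isClosed_image_branchSet⟩
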